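/- Let $\Bbbk$ be an algebraically closed field, $n, d \ge 0$ integers, and $T = \Bbbk[\alpha_1,\dots,\alpha_n]$ with $\mathfrak m = \langle \alpha_1,\dots,\alpha_n\rangle$. Let $F$ be one of the following: (i) $\Bbbk$ has characteristic $0$ (for instance $\Bbbk=\mathbb C$), $F \in S = \Bbbk[x_1,\dots,x_n]$ is a non-zero homogeneous polynomial of degree $d$, and $T$ acts on $S$ by letting $\alpha_i$ act as $\partial/\partial x_i$; or (ii) $\Bbbk$ has any characteristic, $F$ is a non-zero homogeneous element of degree $d$ of the divided power ring $S = \Bbbk[x_1,\dots,x_n]^{DP}$, and $T$ acts on $S$ by letting $\alpha_i$ send $x_1^{(b_1)}\cdots x_n^{(b_n)}$ to $x_1^{(b_1)}\cdots x_i^{(b_i-1)}\cdots x_n^{(b_n)}$ (and to $0$ if $b_i=0$). Let $F^\perp = \{\Theta \in T : \Theta \text{ annihilates } F\}$ be the apolar ideal of $F$. A minimal generator of degree $j$ of $F^\perp$ is an element of $F^\perp$, homogeneous of degree $j$, whose class in $F^\perp/\mathfrak m F^\perp$ is non-zero. For an integer $\delta\ge 0$ let $(F^\perp)_{\le\delta}$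 be the ideal generated by the homogeneous elements of $F^\perp$ of degree at most $\delta$. Then: (a) If $\delta$ is the highest among the degrees of the minimal generators of $F^\perp$, then $d \le (\delta-1)n$. (b) Let $\Theta_1,\dots,\Theta_s$ be a minimal system of homogeneous generators of $F^\perp$, of degrees $d_1\le\dots\le d_s$. Let $\delta$ be an integer such that the ideal $(F^\perp)_{\le\delta}$ is $\mathfrak m$-primary, and let $1\le k\le s$ be such that either $d_k=\delta<d_{k+1}$, or $k=s$ and $d_s=\delta$. Then $k\ge n$ and $$ d \le d_k + d_{k-1} + \dots + d_{k-n+1} - n . $$ -/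

import Mathlib

noncomputable section

open MvPolynomial

section OperatorAction

variable {K : Type*} [Field K] {S : Type*} [AddCommGroup S] [Module K S] {n : ℕ}

theorem pairwise_commute_powersHom (D : Fin n → Module.End K S)
    (hD : ∀ i j, Commute (D i) (D j)) :
    Pairwise fun i j => ∀ (a b : Multiplicative ℕ),
      Commute (powersHom (Module.End K S) (D i) a) (powersHom (Module.End K S) (D j) b) :=
  fun i j _ a b => by
    simpa [powersHom_apply] using (hD i j).pow_pow a.toAdd b.toAdd

/-- For pairwise commuting operators `D 0, …, D (n-1)` on a `K`-vector space `S`, the `K`-algebra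
homomorphism `T = K[α₁, …, αₙ] → End_K S` that sends the variable `αᵢ` to `D i`
(see `operatorAction_X`). -/
def operatorAction (D : Fin n → Module.End K S) (hD : ∀ i j, Commute (D i) (D j)) :
    MvPolynomial (Fin n) K →ₐ[K] Module.End K S :=
  AddMonoidAlgebra.lift K (Module.End K S) (Fin n →₀ ℕ)
    ((MonoidHom.noncommPiCoprod (fun i => powersHom (Module.End K S) (D i))
        (pairwise_commute_powersHom D hD)).comp
      { toFun := fun a i => Multiplicative.ofAdd (a.toAdd i)
        map_one' := rfl
        map_mul' := fun _ _ => rfl })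

theorem operatorAction_X (D : Fin n → Module.End K S) (hD : ∀ i j, Commute (D i) (D j))
    (i : Fin n) : operatorAction D hD (X i) = D i := by
  classical
  have key : (fun j => Multiplicative.ofAdd ((Finsupp.single i 1 : Fin n →₀ ℕ) j)) =
      Pi.mulSingle i (Multiplicative.ofAdd 1) := by
    funext j
    by_cases h : j = i
    · subst h; simp
    · simp [Pi.mulSingle_eq_of_ne h, Finsupp.single_eq_of_ne h]
  rw [operatorAction]
  refine (AddMonoidAlgebra.lift_single _ _ _).trans ?_
  rw [one_smul, MonoidHom.comp_apply]
  refine (congrArg _ key).trans ?_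
  rw [MonoidHom.noncommPiCoprod_mulSingle]
  simp [powersHom_apply]

/-- The annihilator of `F ∈ S` in `T = K[α₁, …, αₙ]`, where `αᵢ` acts on `S` as `D i`. -/
def annihilatorIdeal (D : Fin n → Module.End K S) (hD : ∀ i j, Commute (D i) (D j)) (F : S) :
    Ideal (MvPolynomial (Fin n) K) where
  carrier := {Θ | operatorAction D hD Θ F = 0}
  add_mem' := fun {a b} ha hb => by
    change operatorAction D hD (a + b) F = 0
    have ha' : operatorAction D hD a F = 0 := ha
    have hb' : operatorAction D hD b F = 0 := hb
    simp [ha', hb']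
  zero_mem' := by
    change operatorAction D hD 0 F = 0
    simp
  smul_mem' := fun c Θ h => by
    change operatorAction D hD (c * Θ) F = 0
    have h' : operatorAction D hD Θ F = 0 := h
    simp [h']

end OperatorAction

section Differentiation

variable {K : Type*} [Field K] {n : ℕ}

/-- The partial derivative `∂/∂xᵢ` as a `K`-linear operator on `K[x₁, …, xₙ]`. -/
def partialDerivative (i : Fin n) : Module.End K (MvPolynomial (Fin n) K) :=
  (pderiv i : Derivation K (MvPolynomial (Fin n) K) (MvPolynomial (Fin n) K)).toLinearMap

theorem partialDerivative_commute (i j : Fin n) :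
    Commute (partialDerivative i : Module.End K (MvPolynomial (Fin n) K))
      (partialDerivative j) := by
  have h : ⁅(pderiv i : Derivation K (MvPolynomial (Fin n) K) (MvPolynomial (Fin n) K)),
      (pderiv j : Derivation K (MvPolynomial (Fin n) K) (MvPolynomial (Fin n) K))⁆ = 0 := by
    refine MvPolynomial.derivation_ext fun l => ?_
    classical
    simp only [Derivation.commutator_apply, pderiv_X, Pi.single_apply, Derivation.coe_zero,
      Pi.zero_apply]
    split_ifs <;> simp
  refine LinearMap.ext fun p => ?_
  have := congrArg (fun D => D p) h
  simpa [partialDerivative, Derivation.commutator_apply, sub_eq_zero] using this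

/-- The apolar ideal `F^⊥ ⊆ T = K[α₁, …, αₙ]` of a polynomial `F ∈ S = K[x₁, …, xₙ]`:
all `Θ` with `Θ ⌟ F = 0`, where `αᵢ` acts on `S` as the partial derivative `∂/∂xᵢ`. -/
def apolarIdeal (F : MvPolynomial (Fin n) K) : Ideal (MvPolynomial (Fin n) K) :=
  annihilatorIdeal partialDerivative partialDerivative_commute F

end Differentiation

section DividedPowers

variable (K : Type*) [Field K] (n : ℕ)

/-- The divided power ring `K[x₁, …, xₙ]^DP` as a `K`-vector space with its standard basis of
divided power monomials `x₁^(b₁) ⋯ xₙ^(bₙ)`: the function `F : (Fin n →₀ ℕ) →₀ K` stands for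
`∑ b, F b • x₁^(b₁) ⋯ xₙ^(bₙ)`.  (The multiplication plays no role for apolarity.) -/
abbrev DividedPowerPoly : Type _ := (Fin n →₀ ℕ) →₀ K

variable {K n}

/-- `F` is a divided power form of degree `d`: only divided power monomials of degree `d` occur. -/
def DividedPowerPoly.IsForm (F : DividedPowerPoly K n) (d : ℕ) : Prop :=
  ∀ b : Fin n →₀ ℕ, F b ≠ 0 → b.degree = d

/-- The operator `x₁^(b₁) ⋯ xₙ^(bₙ) ↦ x₁^(b₁) ⋯ xᵢ^(bᵢ - 1) ⋯ xₙ^(bₙ)` (and `↦ 0` if `bᵢ = 0`):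
the coefficient of the result at `b` is the old coefficient at `b + eᵢ`. -/
def contraction (i : Fin n) : Module.End K (DividedPowerPoly K n) :=
  Finsupp.lcomapDomain (fun b => b + Finsupp.single i 1) (add_left_injective _)

theorem contraction_apply (i : Fin n) (F : DividedPowerPoly K n) (b : Fin n →₀ ℕ) :
    contraction i F b = F (b + Finsupp.single i 1) := rfl

theorem contraction_commute (i j : Fin n) :
    Commute (contraction i : Module.End K (DividedPowerPoly K n)) (contraction j) := by
  refine LinearMap.ext fun F => Finsupp.ext fun b => ?_
  simp only [Module.End.mul_apply, contraction_apply]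
  rw [add_right_comm]

/-- The apolar ideal `F^⊥ ⊆ T = K[α₁, …, αₙ]` of an element `F` of the divided power ring:
all `Θ` with `Θ ⌟ F = 0`, where `αᵢ` acts as `xᵢ^(b) ↦ xᵢ^(b - 1)`. -/
def dpApolarIdeal (F : DividedPowerPoly K n) : Ideal (MvPolynomial (Fin n) K) :=
  annihilatorIdeal contraction contraction_commute F

end DividedPowers

section Generators

variable {K : Type*} [Field K] {n : ℕ}

/-- `Θ ∈ I` represents a minimal generator of degree `j` of the homogeneous ideal `I`:
it is homogeneous of degree `j` and its class in `I / 𝔪 I` is non-zero,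
`𝔪 = ⟨α₁, …, αₙ⟩`. -/
def IsMinimalGenerator (I : Ideal (MvPolynomial (Fin n) K)) (j : ℕ)
    (Θ : MvPolynomial (Fin n) K) : Prop :=
  Θ ∈ I ∧ Θ.IsHomogeneous j ∧ Θ ∉ idealOfVars (Fin n) K * I

/-- `Θ₁, …, Θₛ` is a minimal system of homogeneous generators of the homogeneous ideal `I`, of
degrees `d₁, …, dₛ`: each `Θᵢ` is a minimal generator of degree `dᵢ`, together they generate `I`,
and their classes in `I / 𝔪 I` are linearly independent over `K`. -/
structure IsMinimalGeneratingSystem (I : Ideal (MvPolynomial (Fin n) K)) {s : ℕ}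
    (Θ : Fin s → MvPolynomial (Fin n) K) (deg : Fin s → ℕ) : Prop where
  isMinimalGenerator : ∀ i, IsMinimalGenerator I (deg i) (Θ i)
  span_eq : Ideal.span (Set.range Θ) = I
  independent : ∀ c : Fin s → K, ∑ i, c i • Θ i ∈ idealOfVars (Fin n) K * I → ∀ i, c i = 0

/-- The ideal `I_{≤ δ}` generated by the homogeneous elements of `I` of degree at most `δ`. -/
def truncatedIdeal (I : Ideal (MvPolynomial (Fin n) K)) (δ : ℕ) :
    Ideal (MvPolynomial (Fin n) K) :=
  Ideal.span {Θ | Θ ∈ I ∧ ∃ j ≤ δ, Θ.IsHomogeneous j}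

/-- `J` is `𝔪`-primary, `𝔪 = ⟨α₁, …, αₙ⟩`. -/
def IsIrrelevantPrimary (J : Ideal (MvPolynomial (Fin n) K)) : Prop :=
  J.IsPrimary ∧ J.radical = idealOfVars (Fin n) K

end Generators

end

/-! About `F^⊥` only three facts are needed: it is graded, it contains every form of degree above
`d`, and it misses some form `u` of degree `d`. Both bounds follow from one statement,
`mem_span_of_sum_lt`: if forms `f j`, of increasing degrees `e j`, generate an ideal whose radical
contains `𝔪`, that ideal contains every form of degree above the sum of `e j - 1` over the last `n`
degrees. Applied inside `F^⊥`, it would capture `u` if `d` exceeded that sum.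

To prove it, general forms are chosen in the ideal, one in each of the last `n` degrees, so that
they are a regular sequence (`exists_hilbertSeries_eq`). Each choice avoids the associated primes of
the previous ideal, which is possible because `K` is infinite and, by depth and Krull's height
theorem, too few `f j` remain to reach `𝔪` from such a prime (`HasDepth.exists_notMem`). The
quotient then has Hilbert series `∏ (1 - t^e) / (1 - t)^n`, a polynomial of degree at most the sum
of the `e - 1`.

Part (b) takes for `f` the minimal generators of degree at most `δ`; part (a) takes generators of
the ideal spanned by the degree `δ` piece of `F^⊥`. -/

section

open MvPolynomial

/-! ### Non-zero-divisors modulo an ideal, Krull's height theorem, avoidance of ideals. -/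

section RegularMod

variable {R : Type*} [CommRing R]

/-- `x` is a non-zero-divisor on `R / J`. -/
def RegularMod (J : Ideal R) (x : R) : Prop := ∀ u, x * u ∈ J → u ∈ J

theorem mem_associatedPrimes_quotient_iff [IsNoetherianRing R] {J P : Ideal R} :
    P ∈ associatedPrimes R (R ⧸ J) ↔ P.IsPrime ∧ ∃ u, ∀ r, r ∈ P ↔ r * u ∈ J := by
  rw [AssociatedPrimes.mem_iff, isAssociatedPrime_iff]
  refine and_congr_right fun _ => ⟨?_, ?_⟩
  · rintro ⟨x, rfl⟩
    obtain ⟨u, rfl⟩ := Ideal.Quotient.mk_surjective x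
    refine ⟨u, fun r => ?_⟩
    rw [Submodule.mem_colon_singleton, Submodule.mem_bot, ← Ideal.Quotient.eq_zero_iff_mem,
      map_mul, Algebra.smul_def]
    rfl
  · rintro ⟨u, hu⟩
    refine ⟨Ideal.Quotient.mk J u, ?_⟩
    ext r
    rw [hu, Submodule.mem_colon_singleton, Submodule.mem_bot, ← Ideal.Quotient.eq_zero_iff_mem,
      map_mul, Algebra.smul_def]
    rfl

theorem exists_associatedPrime_of_notMem [IsNoetherianRing R] {J : Ideal R} {u : R} (hu : u ∉ J) :
    ∃ P ∈ associatedPrimes R (R ⧸ J), ∀ r, r * u ∈ J → r ∈ P := by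
  have h0 : Ideal.Quotient.mk J u ≠ 0 := by rwa [Ne, Ideal.Quotient.eq_zero_iff_mem]
  obtain ⟨P, hP, hle⟩ := exists_le_isAssociatedPrime_of_isNoetherianRing R _ h0
  refine ⟨P, hP, fun r hr => hle ?_⟩
  rw [Submodule.mem_colon_singleton, Submodule.mem_bot, Algebra.smul_def]
  rw [← Ideal.Quotient.eq_zero_iff_mem, map_mul] at hr
  exact hr

theorem regularMod_of_forall_associatedPrimes [IsNoetherianRing R] {J : Ideal R} {x : R}
    (h : ∀ P ∈ associatedPrimes R (R ⧸ J), x ∉ P) : RegularMod J x := by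
  intro u hu
  by_contra hn
  obtain ⟨P, hP, hle⟩ := exists_associatedPrime_of_notMem hn
  exact h P hP (hle x hu)

/-- This is the half of permuting a regular sequence that needs no grading: if `a * u = j + b * v`,
then `v` is `w * a` modulo `J`, and cancelling `a` leaves `u` congruent to `w * b`. -/
theorem RegularMod.swap {J : Ideal R} {a b : R} (ha : RegularMod J a)
    (hb : RegularMod (J ⊔ Ideal.span {a}) b) : RegularMod (J ⊔ Ideal.span {b}) a := by
  intro u hu
  obtain ⟨j, hj, _, hbv, hjv⟩ := Submodule.mem_sup.1 hu
  obtain ⟨v, rfl⟩ := Ideal.mem_span_singleton'.1 hbv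
  have h1 : b * v ∈ J ⊔ Ideal.span {a} := by
    have : b * v = -j + u * a := by linear_combination hjv
    rw [this]
    exact Submodule.add_mem_sup (J.neg_mem hj) (Ideal.mem_span_singleton'.2 ⟨u, rfl⟩)
  obtain ⟨j', hj', _, haw, hjw⟩ := Submodule.mem_sup.1 (hb v h1)
  obtain ⟨w, rfl⟩ := Ideal.mem_span_singleton'.1 haw
  have h2 : u - w * b ∈ J := by
    refine ha _ ?_
    have : a * (u - w * b) = j + b * j' := by linear_combination -hjv - b * hjw
    rw [this]
    exact J.add_mem hj (J.mul_mem_left _ hj')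
  have : u = (u - w * b) + w * b := by ring
  rw [this]
  exact Submodule.add_mem_sup h2 (Ideal.mem_span_singleton'.2 ⟨w, rfl⟩)

/-- If `x` and `θ` in `m` are non-zero-divisors on `R / J`, then the socle of `R / (J + (θ))` with
respect to `m` vanishes as soon as that of `R / (J + (x))` does. -/
theorem socle_eq_zero_exchange {J m : Ideal R} {x θ : R} (hxm : x ∈ m)
    (hx : RegularMod J x) (hθ : RegularMod J θ)
    (h : ∀ u, (∀ a ∈ m, a * u ∈ J ⊔ Ideal.span {x}) → u ∈ J ⊔ Ideal.span {x}) (u : R)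
    (hu : ∀ a ∈ m, a * u ∈ J ⊔ Ideal.span {θ}) : u ∈ J ⊔ Ideal.span {θ} := by
  -- The relation `x * u ≡ v * θ` modulo `J` carries the socle class `u` modulo `θ` to a socle class
  -- `v` modulo `x`.
  obtain ⟨j, hj, _, hv, hjv⟩ := Submodule.mem_sup.1 (hu x hxm)
  obtain ⟨v, rfl⟩ := Ideal.mem_span_singleton'.1 hv
  have hvx : v ∈ J ⊔ Ideal.span {x} := by
    refine h v fun a ha => ?_
    obtain ⟨i, hi, _, hw, hiw⟩ := Submodule.mem_sup.1 (hu a ha)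
    obtain ⟨w, rfl⟩ := Ideal.mem_span_singleton'.1 hw
    have h1 : a * v - w * x ∈ J := by
      refine hθ _ ?_
      have : θ * (a * v - w * x) = x * i - a * j := by linear_combination a * hjv - x * hiw
      rw [this]
      exact J.sub_mem (J.mul_mem_left _ hi) (J.mul_mem_left _ hj)
    have : a * v = (a * v - w * x) + w * x := by ring
    rw [this]
    exact Submodule.add_mem_sup h1 (Ideal.mem_span_singleton'.2 ⟨w, rfl⟩)
  obtain ⟨i, hi, _, hw, hiw⟩ := Submodule.mem_sup.1 hvx
  obtain ⟨w, rfl⟩ := Ideal.mem_span_singleton'.1 hw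
  have h2 : u - w * θ ∈ J := by
    refine hx _ ?_
    have : x * (u - w * θ) = j + θ * i := by linear_combination -hjv - θ * hiw
    rw [this]
    exact J.add_mem hj (J.mul_mem_left _ hi)
  have : u = (u - w * θ) + w * θ := by ring
  rw [this]
  exact Submodule.add_mem_sup h2 (Ideal.mem_span_singleton'.2 ⟨w, rfl⟩)

/-- If `t` primes strictly above `P` form a chain inside a prime `m` that is minimal over
`P + (s)`, then `t ≤ |s|`. -/
theorem length_le_card_of_le_radical [IsNoetherianRing R] (l : LTSeries (PrimeSpectrum R))
    {m : Ideal R} [m.IsPrime] (hlast : l.last.asIdeal ≤ m) (s : Finset R) (hsm : (s : Set R) ⊆ m)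
    (hs : m ≤ (l.head.asIdeal ⊔ Ideal.span s).radical) : l.length ≤ s.card := by
  classical
  set P := l.head.asIdeal with hP
  -- Modulo `P` the chain stays strict and `m` becomes a minimal prime over the image of `s`, so
  -- Krull's height theorem applies.
  set f := Ideal.Quotient.mk P with hf
  have hfs : Function.Surjective f := Ideal.Quotient.mk_surjective
  have hle : ∀ i, P ≤ (l i).asIdeal := fun i => l.monotone (Fin.zero_le i)
  have hPm : P ≤ m := le_trans (show l.head ≤ l.last from l.monotone (Fin.zero_le _)) hlast
  have hcm : ∀ I : Ideal R, P ≤ I → (I.map f).comap f = I := fun I hI => by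
    rw [Ideal.comap_map_of_surjective f hfs, ← RingHom.ker_eq_comap_bot, Ideal.mk_ker, sup_eq_left]
    exact hI
  have hprime : ∀ I : Ideal R, I.IsPrime → P ≤ I → (I.map f).IsPrime := fun I hI hPI =>
    Ideal.map_isPrime_of_surjective hfs (by rwa [Ideal.mk_ker])
  have hmp : (m.map f).IsPrime := hprime m inferInstance hPm
  let l' : LTSeries (PrimeSpectrum (R ⧸ P)) :=
    { length := l.length
      toFun := fun i => ⟨(l i).asIdeal.map f, hprime _ (l i).2 (hle i)⟩
      step := fun i => by
        have hlt : (l i.castSucc).asIdeal < (l i.succ).asIdeal := l.step i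
        change ((l i.castSucc).asIdeal.map f) < ((l i.succ).asIdeal.map f)
        refine lt_of_le_of_ne (Ideal.map_mono hlt.le) fun h => hlt.ne ?_
        rw [← hcm _ (hle i.castSucc), h, hcm _ (hle _)] }
  have hlen : (l.length : ℕ∞) ≤ (m.map f).height := by
    have := Order.length_le_height (p := l') (x := ⟨m.map f, hmp⟩) (Ideal.map_mono hlast)
    rwa [← PrimeSpectrum.height_eq_orderHeight] at this
  have hmin : m.map f ∈ (Ideal.span ((s.image f : Finset (R ⧸ P)) : Set (R ⧸ P))).minimalPrimes := by
    have hspan : Ideal.span ((s.image f : Finset (R ⧸ P)) : Set (R ⧸ P)) =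
        (Ideal.span (s : Set R)).map f := by
      rw [Finset.coe_image, Ideal.map_span]
    rw [hspan]
    refine ⟨⟨hmp, Ideal.map_mono (Ideal.span_le.2 hsm)⟩, ?_⟩
    rintro Q ⟨hQ, hQs⟩ -
    rw [Ideal.map_le_iff_le_comap] at hQs ⊢
    have := hQ
    have hPQ : P ≤ Q.comap f := fun x hx => by
      rw [Ideal.mem_comap, Ideal.Quotient.eq_zero_iff_mem.2 hx]
      exact Q.zero_mem
    exact hs.trans ((Ideal.IsPrime.radical_le_iff (Ideal.IsPrime.comap f)).2 (sup_le hPQ hQs))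
  have h3 := hlen.trans (Ideal.height_le_card_of_mem_minimalPrimes_span_finset hmin)
  exact (Nat.cast_le.1 h3).trans Finset.card_image_le

/-- A subspace of a `K`-algebra, `K` infinite, that is contained in none of finitely many ideals
contains an element outside all of them. -/
theorem exists_mem_forall_notMem_ideal {K : Type*} [Field K] [Infinite K] [Algebra K R]
    (V : Submodule K R) {S : Set (Ideal R)} (hS : S.Finite)
    (h : ∀ P ∈ S, ∃ v ∈ V, v ∉ P) : ∃ v ∈ V, ∀ P ∈ S, v ∉ P := by
  by_contra! hc
  have := hS.to_subtype
  let p : S → Subspace K V := fun P => ((P : Ideal R).restrictScalars K).comap V.subtype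
  -- A vector space over an infinite field is not a finite union of proper subspaces.
  have hcov : ⋃ i, (p i : Set V) = Set.univ := by
    refine Set.eq_univ_of_forall fun v => ?_
    obtain ⟨P, hP, hv⟩ := hc v v.2
    exact Set.mem_iUnion.2 ⟨⟨P, hP⟩, hv⟩
  obtain ⟨P, hP⟩ := Subspace.exists_eq_top_of_iUnion_eq_univ hcov
  obtain ⟨v, hvV, hvP⟩ := h P P.2
  have : (⟨v, hvV⟩ : V) ∈ p P := by rw [hP]; trivial
  exact hvP this

end RegularMod

/-! ### Graded ideals and depth measured by forms. -/

section Graded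

variable {K : Type*} [Field K] {n : ℕ}

/-- `J` contains the homogeneous components of its elements. -/
def IsGradedIdeal (J : Ideal (MvPolynomial (Fin n) K)) : Prop :=
  ∀ p ∈ J, ∀ j, homogeneousComponent j p ∈ J

theorem homogeneousComponent_mul_of_isHomogeneous {x : MvPolynomial (Fin n) K} {e : ℕ}
    (hx : x.IsHomogeneous e) (p : MvPolynomial (Fin n) K) (k : ℕ) :
    homogeneousComponent k (x * p) =
      if e ≤ k then x * homogeneousComponent (k - e) p else 0 := by
  conv_lhs => rw [← sum_homogeneousComponent p, Finset.mul_sum, map_sum]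
  have h : ∀ i, homogeneousComponent k (x * homogeneousComponent i p) =
      if e + i = k then x * homogeneousComponent i p else 0 := fun i => by
    rw [homogeneousComponent_of_mem
      ((mem_homogeneousSubmodule _ _).2 (hx.mul (homogeneousComponent_isHomogeneous i p)))]
    simp only [eq_comm]
  simp only [h]
  split_ifs with hk
  · rw [Finset.sum_eq_single (k - e)]
    · rw [if_pos (by omega)]
    · intro i _ hi
      rw [if_neg (by omega)]
    · intro hi
      rw [if_pos (by omega), homogeneousComponent_eq_zero, mul_zero]
      rw [Finset.mem_range] at hi
      omega
  · exact Finset.sum_eq_zero fun i _ => if_neg (by omega)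

theorem IsGradedIdeal.sup_span {J : Ideal (MvPolynomial (Fin n) K)} (hJ : IsGradedIdeal J)
    {x : MvPolynomial (Fin n) K} {e : ℕ} (hx : x.IsHomogeneous e) :
    IsGradedIdeal (J ⊔ Ideal.span {x}) := by
  intro p hp j
  obtain ⟨q, hq, _, hv, rfl⟩ := Submodule.mem_sup.1 hp
  obtain ⟨a, rfl⟩ := Ideal.mem_span_singleton'.1 hv
  rw [map_add, mul_comm a, homogeneousComponent_mul_of_isHomogeneous hx]
  refine Submodule.add_mem_sup (hJ q hq j) ?_
  split_ifs
  · exact Ideal.mul_mem_right _ _ (Ideal.mem_span_singleton_self x)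
  · exact zero_mem _

theorem isGradedIdeal_bot : IsGradedIdeal (⊥ : Ideal (MvPolynomial (Fin n) K)) := by
  intro p hp j
  rw [Ideal.mem_bot] at hp ⊢
  rw [hp, map_zero]

/-- Polynomials with non-zero constant term are non-zero-divisors modulo graded ideals. -/
theorem IsGradedIdeal.regularMod {J : Ideal (MvPolynomial (Fin n) K)} (hJ : IsGradedIdeal J)
    {r : MvPolynomial (Fin n) K} (hr : coeff 0 r ≠ 0) : RegularMod J r := by
  intro u hu
  -- In degree `j`, `r * u` is the constant term of `r` times the component of `u`, plus multiples
  -- of lower components of `u`.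
  have key : ∀ j, homogeneousComponent j u ∈ J := by
    intro j
    induction j using Nat.strong_induction_on with
    | _ j ih =>
      have h1 := hJ _ hu j
      rw [← sum_homogeneousComponent r, Finset.sum_mul, map_sum, Finset.sum_range_succ',
        homogeneousComponent_zero, homogeneousComponent_mul_of_isHomogeneous (isHomogeneous_C _ _),
        if_pos (Nat.zero_le _), Nat.sub_zero] at h1
      rw [Ideal.add_mem_iff_right] at h1
      · have h2 := J.mul_mem_left (C (coeff 0 r)⁻¹) h1
        rwa [← mul_assoc, ← C_mul, inv_mul_cancel₀ hr, C_1, one_mul] at h2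
      · refine J.sum_mem fun i _ => ?_
        rw [homogeneousComponent_mul_of_isHomogeneous (homogeneousComponent_isHomogeneous _ _)]
        split_ifs
        · exact J.mul_mem_left _ (ih _ (by omega))
        · exact J.zero_mem
  rw [← sum_homogeneousComponent u]
  exact J.sum_mem fun i _ => key i

theorem mem_idealOfVars_iff {p : MvPolynomial (Fin n) K} :
    p ∈ idealOfVars (Fin n) K ↔ coeff 0 p = 0 := by
  have := mem_pow_idealOfVars_iff' (σ := Fin n) (R := K) 1 p
  rw [pow_one] at this
  rw [this]
  refine ⟨fun h => h 0 (by simp), fun h x hx => ?_⟩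
  rw [Nat.lt_one_iff, Finsupp.degree_eq_zero_iff] at hx
  rw [hx, h]

instance isPrime_idealOfVars : (idealOfVars (Fin n) K).IsPrime := by
  have : idealOfVars (Fin n) K = RingHom.ker (constantCoeff (σ := Fin n) (R := K)) := by
    ext p
    rw [mem_idealOfVars_iff, RingHom.mem_ker, constantCoeff_eq]
  rw [this]
  exact RingHom.ker_isPrime _

theorem mem_idealOfVars_of_isHomogeneous {x : MvPolynomial (Fin n) K} {e : ℕ}
    (hx : x.IsHomogeneous e) (he : e ≠ 0) : x ∈ idealOfVars (Fin n) K :=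
  mem_idealOfVars_iff.2 (hx.coeff_eq_zero (by simpa using he.symm))

theorem IsGradedIdeal.associatedPrime_le {J P : Ideal (MvPolynomial (Fin n) K)}
    (hJ : IsGradedIdeal J) (hP : P ∈ associatedPrimes _ (MvPolynomial (Fin n) K ⧸ J)) :
    P ≤ idealOfVars (Fin n) K := by
  obtain ⟨hPp, u, hu⟩ := mem_associatedPrimes_quotient_iff.1 hP
  intro r hr
  rw [mem_idealOfVars_iff]
  by_contra h0
  have huJ : u ∈ J := hJ.regularMod h0 u ((hu r).1 hr)
  exact hPp.ne_top ((Ideal.eq_top_iff_one _).2 ((hu 1).2 (by rwa [one_mul])))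

/-- There is a sequence of `t` forms of positive degree that is regular on `T / J`. -/
def HasDepth : ℕ → Ideal (MvPolynomial (Fin n) K) → Prop
  | 0, _ => True
  | t + 1, J => ∃ (x : MvPolynomial (Fin n) K) (e : ℕ), x.IsHomogeneous e ∧ e ≠ 0 ∧
      RegularMod J x ∧ HasDepth t (J ⊔ Ideal.span {x})

/-- Every associated prime of a graded ideal of depth at least `t` is the bottom of a chain of
`t + 1` primes contained in the irrelevant ideal. -/
theorem HasDepth.exists_ltSeries {t : ℕ} : ∀ {J P : Ideal (MvPolynomial (Fin n) K)},
    HasDepth t J → IsGradedIdeal J → P ∈ associatedPrimes _ (MvPolynomial (Fin n) K ⧸ J) →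
    ∃ l : LTSeries (PrimeSpectrum (MvPolynomial (Fin n) K)),
      l.length = t ∧ l.head.asIdeal = P ∧ l.last.asIdeal ≤ idealOfVars (Fin n) K := by
  induction t with
  | zero =>
    intro J P _ hJ hP
    exact ⟨RelSeries.singleton _ ⟨P, (mem_associatedPrimes_quotient_iff.1 hP).1⟩, rfl, rfl,
      hJ.associatedPrime_le hP⟩
  | succ t ih =>
    rintro J P ⟨x, e, hx, he, hreg, hd⟩ hJ hP
    obtain ⟨hPp, u, hu⟩ := mem_associatedPrimes_quotient_iff.1 hP
    have huJ : u ∉ J := fun h =>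
      hPp.ne_top ((Ideal.eq_top_iff_one _).2 ((hu 1).2 (by rwa [one_mul])))
    have hxP : x ∉ P := fun h => huJ (hreg u ((hu x).1 h))
    -- an element annihilated by `P` modulo `J`, but not in `J + (x)`
    obtain ⟨w, hwP, hw⟩ : ∃ w, (∀ r ∈ P, r * w ∈ J) ∧ w ∉ J ⊔ Ideal.span {x} := by
      by_contra! hc
      let N : Ideal (MvPolynomial (Fin n) K) :=
        { carrier := {w | ∀ r ∈ P, r * w ∈ J}
          add_mem' := fun {a b} ha hb r hr => by
            rw [mul_add]
            exact J.add_mem (ha r hr) (hb r hr)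
          zero_mem' := fun r _ => by
            rw [mul_zero]
            exact J.zero_mem
          smul_mem' := fun c a ha r hr => by
            rw [smul_eq_mul, mul_left_comm]
            exact J.mul_mem_left _ (ha r hr) }
      have hN : Submodule.map J.mkQ N ≤ Ideal.span {x} • Submodule.map J.mkQ N := by
        rintro _ ⟨w, hw, rfl⟩
        obtain ⟨j, hj, _, hv, rfl⟩ := Submodule.mem_sup.1 (hc w hw)
        obtain ⟨a, rfl⟩ := Ideal.mem_span_singleton'.1 hv
        have ha : a ∈ N := fun r hr => hreg _ <| by
          have h1 := J.sub_mem (hw r hr) (J.mul_mem_left r hj)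
          have h2 : r * (j + a * x) - r * j = x * (r * a) := by ring
          rwa [h2] at h1
        have h3 : J.mkQ (j + a * x) = x • J.mkQ a := by
          rw [← map_smul, smul_eq_mul, mul_comm x, map_add, add_eq_right]
          exact (Submodule.Quotient.mk_eq_zero J).2 hj
        rw [h3]
        exact Submodule.smul_mem_smul (Ideal.mem_span_singleton_self x) ⟨a, ha, rfl⟩
      -- Nakayama: `r` kills `N` modulo `J`, hence `u`. But `r - 1` is a multiple of `x`, so `r` has
      -- constant term `1` and is regular modulo `J`.
      obtain ⟨r, hr, hrN⟩ := Submodule.exists_sub_one_mem_and_smul_eq_zero_of_fg_of_le_smul _ _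
        (IsNoetherian.noetherian _) hN
      have hru : r * u ∈ J := by
        have := hrN (J.mkQ u) ⟨u, fun r hr => (hu r).1 hr, rfl⟩
        rw [← map_smul] at this
        exact (Submodule.Quotient.mk_eq_zero J).1 this
      obtain ⟨a, ha⟩ := Ideal.mem_span_singleton'.1 hr
      have hr0 : coeff 0 r ≠ 0 := by
        have h4 := mem_idealOfVars_iff.1 (Ideal.mul_mem_left _ a
          (mem_idealOfVars_of_isHomogeneous hx he))
        rw [ha, coeff_sub, coeff_zero_one, sub_eq_zero] at h4
        rw [h4]
        exact one_ne_zero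
      exact huJ (hJ.regularMod hr0 u hru)
    obtain ⟨Q, hQ, hle⟩ := exists_associatedPrime_of_notMem hw
    obtain ⟨l, hl, hhead, hlast⟩ := ih hd (hJ.sup_span hx) hQ
    -- `Q` contains everything that multiplies `w` into `J + (x)`: all of `P`, and also `x`, which
    -- is not in `P`.
    have hPQ : P < Q := by
      refine lt_of_le_of_ne (fun r hr => hle r (Ideal.mem_sup_left (hwP r hr))) ?_
      rintro rfl
      exact hxP (hle x (Ideal.mem_sup_right
        (Ideal.mul_mem_right _ _ (Ideal.mem_span_singleton_self x))))
    exact ⟨l.cons ⟨P, hPp⟩ (show P < l.head.asIdeal by rwa [hhead]), by simp [hl], by simp,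
      by simpa using hlast⟩

/-- If the irrelevant ideal is a minimal prime over `P + (s)`, with `P` an associated prime of a
graded ideal of depth at least `t`, then `t ≤ |s|`. -/
theorem HasDepth.le_card {t : ℕ} {J P : Ideal (MvPolynomial (Fin n) K)}
    (hd : HasDepth t J) (hJ : IsGradedIdeal J)
    (hP : P ∈ associatedPrimes _ (MvPolynomial (Fin n) K ⧸ J))
    (s : Finset (MvPolynomial (Fin n) K)) (hsm : (s : Set (MvPolynomial (Fin n) K)) ⊆
      idealOfVars (Fin n) K) (hs : idealOfVars (Fin n) K ≤ (P ⊔ Ideal.span s).radical) :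
    t ≤ s.card := by
  obtain ⟨l, rfl, rfl, hlast⟩ := hd.exists_ltSeries hJ hP
  exact length_le_card_of_le_radical l hlast s hsm hs

/-- Finitely many primes different from the irrelevant ideal are avoided by a linear form. -/
theorem exists_linear_forall_notMem [Infinite K] {S : Set (Ideal (MvPolynomial (Fin n) K))}
    (hS : S.Finite) (h : ∀ P ∈ S, ¬ idealOfVars (Fin n) K ≤ P) :
    ∃ y : MvPolynomial (Fin n) K, y.IsHomogeneous 1 ∧ ∀ P ∈ S, y ∉ P := by
  obtain ⟨y, hy, hyS⟩ := exists_mem_forall_notMem_ideal (homogeneousSubmodule (Fin n) K 1) hS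
    (fun P hP => by
      by_contra! hc
      refine h P hP (Ideal.span_le.2 ?_)
      rintro _ ⟨i, rfl⟩
      exact hc _ ((mem_homogeneousSubmodule _ _).2 (isHomogeneous_X K i)))
  exact ⟨y, (mem_homogeneousSubmodule _ _).1 hy, hyS⟩

/-- An associated prime is `J : u` with `u ∉ J`; if it contained `𝔪`, then `u` would be a non-zero
socle element. -/
theorem not_idealOfVars_le_of_socle {J P : Ideal (MvPolynomial (Fin n) K)}
    (h : ∀ u, (∀ a ∈ idealOfVars (Fin n) K, a * u ∈ J) → u ∈ J)
    (hP : P ∈ associatedPrimes _ (MvPolynomial (Fin n) K ⧸ J)) :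
    ¬ idealOfVars (Fin n) K ≤ P := by
  obtain ⟨hPp, u, hu⟩ := mem_associatedPrimes_quotient_iff.1 hP
  intro hle
  have huJ := h u fun a ha => (hu a).1 (hle ha)
  exact hPp.ne_top ((Ideal.eq_top_iff_one _).2 ((hu 1).2 (by rwa [one_mul])))

/-- Dividing by a form that is a non-zero-divisor lowers the depth by at most one. -/
theorem HasDepth.sup_span [Infinite K] {t : ℕ} : ∀ {J : Ideal (MvPolynomial (Fin n) K)}
    {θ : MvPolynomial (Fin n) K}, HasDepth (t + 1) J → RegularMod J θ →
    HasDepth t (J ⊔ Ideal.span {θ}) := by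
  induction t with
  | zero => intros; trivial
  | succ t ih =>
    rintro J θ ⟨x, e, hx, he, hxJ, hd⟩ hθ
    obtain ⟨x', e', hx', he', hxJ', -⟩ := id hd
    -- The next form `x'` rules out a socle modulo `x`, and the exchange lemma rules it out modulo
    -- `θ`. So one linear form `y` is regular modulo both.
    have hs1 : ∀ u, (∀ a ∈ idealOfVars (Fin n) K, a * u ∈ J ⊔ Ideal.span {x}) →
        u ∈ J ⊔ Ideal.span {x} := fun u hu =>
      hxJ' u (hu x' (mem_idealOfVars_of_isHomogeneous hx' he'))
    have hs2 := socle_eq_zero_exchange (mem_idealOfVars_of_isHomogeneous hx he) hxJ hθ hs1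
    obtain ⟨y, hy, hyS⟩ := exists_linear_forall_notMem
      (((associatedPrimes.finite (MvPolynomial (Fin n) K)
        (MvPolynomial (Fin n) K ⧸ (J ⊔ Ideal.span {x})))).union
        (associatedPrimes.finite (MvPolynomial (Fin n) K)
        (MvPolynomial (Fin n) K ⧸ (J ⊔ Ideal.span {θ}))))
      (fun P hP => hP.elim (not_idealOfVars_le_of_socle hs1) (not_idealOfVars_le_of_socle hs2))
    have hy1 : RegularMod (J ⊔ Ideal.span {x}) y :=
      regularMod_of_forall_associatedPrimes fun P hP => hyS P (Or.inl hP)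
    have hy2 : RegularMod (J ⊔ Ideal.span {θ}) y :=
      regularMod_of_forall_associatedPrimes fun P hP => hyS P (Or.inr hP)
    -- The form `y` is moved to the front of both sequences; induction is used first for `y` modulo
    -- `J + (x)`, then for `θ` modulo `J + (y)`.
    have hdy : HasDepth (t + 1) (J ⊔ Ideal.span {y}) :=
      ⟨x, e, hx, he, hxJ.swap hy1, by
        rw [sup_right_comm]
        exact ih hd hy1⟩
    refine ⟨y, 1, hy, one_ne_zero, hy2, ?_⟩
    rw [sup_right_comm]
    exact ih hdy (hθ.swap hy2)

theorem regularMod_X_span_X_image {s : Set (Fin n)} {i : Fin n} (hi : i ∉ s) :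
    RegularMod (Ideal.span (X '' s : Set (MvPolynomial (Fin n) K))) (X i) := by
  intro u hu
  rw [mem_ideal_span_X_image] at hu ⊢
  intro m hm
  obtain ⟨j, hj, hmj⟩ := hu (Finsupp.single i 1 + m) (by
    rw [mem_support_iff, coeff_X_mul]
    exact mem_support_iff.1 hm)
  refine ⟨j, hj, ?_⟩
  have hij : i ≠ j := fun h => hi (h ▸ hj)
  simpa [Finsupp.single_eq_of_ne hij.symm] using hmj

theorem span_X_image_succ {i : ℕ} (hi : i < n) :
    Ideal.span (X '' {j : Fin n | (j : ℕ) < i + 1} : Set (MvPolynomial (Fin n) K)) =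
      Ideal.span (X '' {j : Fin n | (j : ℕ) < i}) ⊔ Ideal.span {X ⟨i, hi⟩} := by
  rw [← Ideal.span_union, ← Set.image_singleton (f := X), ← Set.image_union]
  congr 2
  ext j
  simp only [Set.mem_ofPred_eq, Set.mem_union, Set.mem_singleton_iff, Fin.ext_iff]
  omega

theorem hasDepth_span_X_image {t : ℕ} : ∀ {i : ℕ}, i + t = n →
    HasDepth t (Ideal.span (X '' {j : Fin n | (j : ℕ) < i} : Set (MvPolynomial (Fin n) K))) := by
  induction t with
  | zero => intros; trivial
  | succ t ih =>
    intro i hi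
    refine ⟨X ⟨i, by omega⟩, 1, isHomogeneous_X K _, one_ne_zero,
      regularMod_X_span_X_image (by simp), ?_⟩
    rw [← span_X_image_succ]
    exact ih (by omega)

theorem hasDepth_bot : HasDepth n (⊥ : Ideal (MvPolynomial (Fin n) K)) := by
  have := hasDepth_span_X_image (K := K) (n := n) (zero_add n)
  simpa using this

end Graded

theorem card_filter_le_add {n k : ℕ} (hnk : n ≤ k) :
    (Finset.univ.filter fun j : Fin k => k ≤ (j : ℕ) + n).card = n := by
  have h := Fin.card_filter_val_lt (n := k) (m := k - n)
  have h2 := Finset.card_filter_add_card_filter_not (s := (Finset.univ : Finset (Fin k)))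
    (fun j => (j : ℕ) < k - n)
  have h3 : (Finset.univ.filter fun j : Fin k => ¬ (j : ℕ) < k - n) =
      Finset.univ.filter fun j : Fin k => k ≤ (j : ℕ) + n :=
    Finset.filter_congr fun j _ => by omega
  rw [h3, Finset.card_univ, Fintype.card_fin] at h2
  omega

/-! ### Hilbert series of complete intersections. -/

section Hilbert

variable {K : Type*} [Field K] {n : ℕ}

/-- The forms of degree `D` in the ideal `J`. -/
noncomputable def idealPart (J : Ideal (MvPolynomial (Fin n) K)) (D : ℕ) :
    Submodule K (MvPolynomial (Fin n) K) :=
  homogeneousSubmodule (Fin n) K D ⊓ J.restrictScalars K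

theorem mem_idealPart {J : Ideal (MvPolynomial (Fin n) K)} {D : ℕ}
    {p : MvPolynomial (Fin n) K} : p ∈ idealPart J D ↔ p.IsHomogeneous D ∧ p ∈ J := by
  rw [idealPart, Submodule.mem_inf, mem_homogeneousSubmodule, Submodule.restrictScalars_mem]

instance finiteDimensional_homogeneousSubmodule (D : ℕ) :
    FiniteDimensional K (homogeneousSubmodule (Fin n) K D) :=
  Module.Finite.iff_fg.2 (homogeneousSubmodule_fg (Fin n) K D)

instance finiteDimensional_idealPart (J : Ideal (MvPolynomial (Fin n) K)) (D : ℕ) :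
    FiniteDimensional K (idealPart J D) :=
  Submodule.finiteDimensional_inf_left _ _

/-- The Hilbert series of `T / J`, with integer coefficients. -/
noncomputable def hilbertSeries (J : Ideal (MvPolynomial (Fin n) K)) : PowerSeries ℤ :=
  PowerSeries.mk fun D => (Module.finrank K (homogeneousSubmodule (Fin n) K D) : ℤ) -
    Module.finrank K (idealPart J D)

theorem finrank_map_mulLeft {x : MvPolynomial (Fin n) K} (hx : x ≠ 0)
    (V : Submodule K (MvPolynomial (Fin n) K)) :
    Module.finrank K (V.map (LinearMap.mulLeft K x)) = Module.finrank K V :=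
  (LinearEquiv.finrank_eq (Submodule.equivMapOfInjective _
    (fun _ _ h => mul_left_cancel₀ hx h) V)).symm

theorem idealPart_sup_span_of_lt {J : Ideal (MvPolynomial (Fin n) K)} (hJ : IsGradedIdeal J)
    {x : MvPolynomial (Fin n) K} {e D : ℕ} (hx : x.IsHomogeneous e) (hD : D < e) :
    idealPart (J ⊔ Ideal.span {x}) D = idealPart J D := by
  ext p
  rw [mem_idealPart, mem_idealPart]
  refine and_congr_right fun hp => ⟨fun h => ?_, fun h => Ideal.mem_sup_left h⟩
  obtain ⟨q, hq, _, hv, hqv⟩ := Submodule.mem_sup.1 h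
  obtain ⟨a, rfl⟩ := Ideal.mem_span_singleton'.1 hv
  rw [← homogeneousComponent_eq_self hp, ← hqv, map_add, mul_comm a,
    homogeneousComponent_mul_of_isHomogeneous hx, if_neg (by omega), add_zero]
  exact hJ q hq D

theorem idealPart_sup_span {J : Ideal (MvPolynomial (Fin n) K)} (hJ : IsGradedIdeal J)
    {x : MvPolynomial (Fin n) K} {e : ℕ} (hx : x.IsHomogeneous e) (D : ℕ) :
    idealPart (J ⊔ Ideal.span {x}) (e + D) = idealPart J (e + D) ⊔
      (homogeneousSubmodule (Fin n) K D).map (LinearMap.mulLeft K x) := by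
  ext p
  rw [mem_idealPart]
  constructor
  · rintro ⟨hp, h⟩
    obtain ⟨q, hq, _, hv, hqv⟩ := Submodule.mem_sup.1 h
    obtain ⟨a, rfl⟩ := Ideal.mem_span_singleton'.1 hv
    refine Submodule.mem_sup.2 ⟨homogeneousComponent (e + D) q, mem_idealPart.2
      ⟨homogeneousComponent_isHomogeneous _ _, hJ q hq _⟩, x * homogeneousComponent D a,
      ⟨_, homogeneousComponent_mem _ _, rfl⟩, ?_⟩
    rw [← homogeneousComponent_eq_self hp, ← hqv, map_add, mul_comm a,
      homogeneousComponent_mul_of_isHomogeneous hx, if_pos (by omega), Nat.add_sub_cancel_left]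
  · intro h
    obtain ⟨q, hq, _, ⟨a, ha, rfl⟩, rfl⟩ := Submodule.mem_sup.1 h
    rw [mem_idealPart] at hq
    exact ⟨hq.1.add (hx.mul ((mem_homogeneousSubmodule _ _).1 ha)),
      Submodule.add_mem_sup hq.2 (Ideal.mul_mem_right _ _ (Ideal.mem_span_singleton_self x))⟩

theorem idealPart_inf_map_mulLeft {J : Ideal (MvPolynomial (Fin n) K)}
    {x : MvPolynomial (Fin n) K} {e : ℕ} (hx : x.IsHomogeneous e) (hreg : RegularMod J x) (D : ℕ) :
    idealPart J (e + D) ⊓ (homogeneousSubmodule (Fin n) K D).map (LinearMap.mulLeft K x) =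
      (idealPart J D).map (LinearMap.mulLeft K x) := by
  ext p
  rw [Submodule.mem_inf]
  constructor
  · rintro ⟨hp, a, ha, rfl⟩
    exact ⟨a, mem_idealPart.2 ⟨ha, hreg a (mem_idealPart.1 hp).2⟩, rfl⟩
  · rintro ⟨a, ha, rfl⟩
    rw [SetLike.mem_coe, mem_idealPart] at ha
    exact ⟨mem_idealPart.2 ⟨hx.mul ha.1, J.mul_mem_left x ha.2⟩, a, ha.1, rfl⟩

/-- Dividing by a form of degree `e` that is a non-zero-divisor multiplies the Hilbert series by
`1 - t ^ e`. -/
theorem hilbertSeries_sup_span {J : Ideal (MvPolynomial (Fin n) K)} (hJ : IsGradedIdeal J)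
    {x : MvPolynomial (Fin n) K} {e : ℕ} (hx : x.IsHomogeneous e) (hx0 : x ≠ 0)
    (hreg : RegularMod J x) :
    hilbertSeries (J ⊔ Ideal.span {x}) = hilbertSeries J * (1 - PowerSeries.X ^ e) := by
  ext D
  rw [mul_sub, mul_one, map_sub, PowerSeries.coeff_mul_X_pow']
  simp only [hilbertSeries, PowerSeries.coeff_mk]
  split_ifs with hD
  · obtain ⟨D, rfl⟩ := Nat.exists_eq_add_of_le hD
    rw [Nat.add_sub_cancel_left]
    -- Regularity of `x` identifies the intersection with `x` times the degree `D` part of `J`.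
    have h := Submodule.finrank_sup_add_finrank_inf_eq (idealPart J (e + D))
      ((homogeneousSubmodule (Fin n) K D).map (LinearMap.mulLeft K x))
    rw [idealPart_inf_map_mulLeft hx hreg, ← idealPart_sup_span hJ hx, finrank_map_mulLeft hx0,
      finrank_map_mulLeft hx0] at h
    have h' := congrArg (Nat.cast : ℕ → ℤ) h
    push_cast at h'
    linear_combination -h'
  · rw [idealPart_sup_span_of_lt hJ hx (by omega), sub_zero]

theorem hilbertSeries_idealOfVars :
    hilbertSeries (idealOfVars (Fin n) K) = 1 := by
  ext D
  rw [hilbertSeries, PowerSeries.coeff_mk, PowerSeries.coeff_one]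
  split_ifs with hD
  · subst hD
    have h0 : idealPart (idealOfVars (Fin n) K) 0 = ⊥ := by
      rw [eq_bot_iff]
      intro p hp
      obtain ⟨hp0, hpm⟩ := mem_idealPart.1 hp
      rw [← homogeneousComponent_eq_self hp0, homogeneousComponent_zero,
        mem_idealOfVars_iff.1 hpm, C_0]
      exact zero_mem _
    have h1 : Module.finrank K (homogeneousSubmodule (Fin n) K 0) = 1 := by
      rw [homogeneousSubmodule_zero, Submodule.one_eq_span, finrank_span_singleton one_ne_zero]
    rw [h0, h1, finrank_bot]
    norm_num
  · have h0 : idealPart (idealOfVars (Fin n) K) D = homogeneousSubmodule (Fin n) K D := by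
      ext p
      rw [mem_idealPart, mem_homogeneousSubmodule]
      exact and_iff_left_of_imp fun hp => mem_idealOfVars_of_isHomogeneous hp hD
    rw [h0, sub_self]

theorem isGradedIdeal_span_X_image {i : ℕ} (hi : i ≤ n) :
    IsGradedIdeal (Ideal.span (X '' {j : Fin n | (j : ℕ) < i} : Set (MvPolynomial (Fin n) K))) := by
  induction i with
  | zero => simpa using isGradedIdeal_bot
  | succ i ih =>
    rw [span_X_image_succ (by omega)]
    exact (ih (by omega)).sup_span (isHomogeneous_X K _)

theorem hilbertSeries_span_X_image {i : ℕ} (hi : i ≤ n) :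
    hilbertSeries (Ideal.span (X '' {j : Fin n | (j : ℕ) < i} : Set (MvPolynomial (Fin n) K))) =
      hilbertSeries (⊥ : Ideal (MvPolynomial (Fin n) K)) * (1 - PowerSeries.X) ^ i := by
  induction i with
  | zero => simp
  | succ i ih =>
    rw [span_X_image_succ (by omega), hilbertSeries_sup_span
      (isGradedIdeal_span_X_image (by omega)) (isHomogeneous_X K _) (X_ne_zero _)
      (regularMod_X_span_X_image (by simp)), ih (by omega), pow_one, pow_succ, mul_assoc]

/-- Dividing `T` by the variables one at a time multiplies its series by `1 - t` each time and ends
at `T / 𝔪 = K`; no monomials are counted. -/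
theorem hilbertSeries_bot_mul :
    hilbertSeries (⊥ : Ideal (MvPolynomial (Fin n) K)) * (1 - PowerSeries.X) ^ n = 1 := by
  rw [← hilbertSeries_span_X_image le_rfl, ← hilbertSeries_idealOfVars (K := K) (n := n)]
  congr 2
  simp [Set.image_univ]

/-- The power of `1 - X` is split off to cancel the denominator of the series of `T`, leaving a
polynomial. -/
theorem prod_one_sub_X_pow {ι : Type*} (s : Finset ι) (e : ι → ℕ) :
    ∏ j ∈ s, (1 - PowerSeries.X ^ e j : PowerSeries ℤ) = (1 - PowerSeries.X) ^ s.card *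
      ((∏ j ∈ s, ∑ i ∈ Finset.range (e j), Polynomial.X ^ i : Polynomial ℤ) : PowerSeries ℤ) := by
  rw [← Finset.prod_const, ← Polynomial.coeToPowerSeries.ringHom_apply, map_prod,
    ← Finset.prod_mul_distrib]
  refine Finset.prod_congr rfl fun j _ => ?_
  rw [map_sum, ← mul_neg_geom_sum]
  simp

theorem natDegree_prod_geom_sum_le {ι : Type*} (s : Finset ι) (e : ι → ℕ) :
    (∏ j ∈ s, ∑ i ∈ Finset.range (e j), Polynomial.X ^ i : Polynomial ℤ).natDegree ≤
      ∑ j ∈ s, (e j - 1) := by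
  refine (Polynomial.natDegree_prod_le _ _).trans (Finset.sum_le_sum fun j _ => ?_)
  refine Polynomial.natDegree_sum_le_of_forall_le _ _ fun i hi => ?_
  rw [Polynomial.natDegree_X_pow]
  have := Finset.mem_range.1 hi
  omega

/-- An ideal with the Hilbert series of a complete intersection of `n` forms contains all forms
of large degree. -/
theorem mem_of_hilbertSeries_eq {ι : Type*} {s : Finset ι} (hs : s.card = n) {e : ι → ℕ}
    {J : Ideal (MvPolynomial (Fin n) K)}
    (hJ : hilbertSeries J = hilbertSeries (⊥ : Ideal (MvPolynomial (Fin n) K)) *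
      ∏ j ∈ s, (1 - PowerSeries.X ^ e j)) {D : ℕ} (hD : ∑ j ∈ s, (e j - 1) < D)
    {u : MvPolynomial (Fin n) K} (hu : u.IsHomogeneous D) : u ∈ J := by
  rw [prod_one_sub_X_pow, ← mul_assoc, hs, hilbertSeries_bot_mul, one_mul] at hJ
  have h := congrArg (PowerSeries.coeff D) hJ
  rw [Polynomial.coeff_coe, Polynomial.coeff_eq_zero_of_natDegree_lt
    ((natDegree_prod_geom_sum_le s e).trans_lt hD), hilbertSeries, PowerSeries.coeff_mk] at h
  have h1 : idealPart J D = homogeneousSubmodule (Fin n) K D :=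
    Submodule.eq_of_le_of_finrank_eq inf_le_left (by omega)
  have h2 : u ∈ idealPart J D := by rwa [h1, mem_homogeneousSubmodule]
  exact (mem_idealPart.1 h2).2

/-! ### General forms in an ideal with radical `𝔪`. -/

variable {k : ℕ} {f : Fin k → MvPolynomial (Fin n) K} {e : Fin k → ℕ}

theorem bot_mem_associatedPrimes :
    (⊥ : Ideal (MvPolynomial (Fin n) K)) ∈
      associatedPrimes _ (MvPolynomial (Fin n) K ⧸ (⊥ : Ideal (MvPolynomial (Fin n) K))) :=
  mem_associatedPrimes_quotient_iff.2 ⟨Ideal.isPrime_bot, 1, fun r => by rw [mul_one]⟩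

theorem span_range_le_idealOfVars (hf : ∀ j, (f j).IsHomogeneous (e j)) (he : ∀ j, e j ≠ 0) :
    Ideal.span (Set.range f) ≤ idealOfVars (Fin n) K := by
  rw [Ideal.span_le]
  rintro _ ⟨j, rfl⟩
  exact mem_idealOfVars_of_isHomogeneous (hf j) (he j)

/-- At least `n` forms are needed to generate an ideal with radical `(α₁, …, αₙ)`. -/
theorem le_of_idealOfVars_le_radical (hf : ∀ j, (f j).IsHomogeneous (e j)) (he : ∀ j, e j ≠ 0)
    (hrad : idealOfVars (Fin n) K ≤ (Ideal.span (Set.range f)).radical) : n ≤ k := by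
  classical
  have hc : ((Finset.univ.image f : Finset (MvPolynomial (Fin n) K)) :
      Set (MvPolynomial (Fin n) K)) = Set.range f := by simp
  refine ((hasDepth_bot (K := K) (n := n)).le_card isGradedIdeal_bot bot_mem_associatedPrimes
    (Finset.univ.image f) ?_ ?_).trans (Finset.card_image_le.trans (by simp))
  · rw [hc, ← Ideal.span_le]
    exact span_range_le_idealOfVars hf he
  · rwa [hc, bot_sup_eq]

/-- An associated prime of a graded ideal of depth at least `t` does not contain the forms of
degree `e p` in `(f j | j ≤ p)` if fewer than `t` of the forms `f` come after `f p`. -/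
theorem HasDepth.exists_notMem (hf : ∀ j, (f j).IsHomogeneous (e j)) (he : ∀ j, e j ≠ 0)
    (hmono : Monotone e) (hrad : idealOfVars (Fin n) K ≤ (Ideal.span (Set.range f)).radical)
    {t : ℕ} {J P : Ideal (MvPolynomial (Fin n) K)} (hd : HasDepth t J) (hJ : IsGradedIdeal J)
    (hP : P ∈ associatedPrimes _ (MvPolynomial (Fin n) K ⧸ J)) (p : Fin k) (hp : k ≤ p + t) :
    ∃ v ∈ idealPart (Ideal.span (Set.range f)) (e p), v ∉ P := by
  classical
  by_contra! hc
  have hPp := (mem_associatedPrimes_quotient_iff.1 hP).1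
  -- Powers of the variables raise `f j` to degree `e p`; if these products lie in `P` but `f j`
  -- does not, then `P` contains `𝔪`, hence `f j`.
  have hfP : ∀ j ≤ p, f j ∈ P := by
    intro j hj
    by_contra hjP
    have hm : idealOfVars (Fin n) K ≤ P := by
      rw [Ideal.span_le]
      rintro _ ⟨i, rfl⟩
      have h1 : X i ^ (e p - e j) * f j ∈ P := by
        refine hc _ (mem_idealPart.2 ⟨?_, Ideal.mul_mem_left _ _ (Ideal.subset_span ⟨j, rfl⟩)⟩)
        have h2 := (isHomogeneous_X_pow (R := K) i (e p - e j)).mul (hf j)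
        rwa [Nat.sub_add_cancel (hmono hj)] at h2
      exact hPp.mem_of_pow_mem _ ((hPp.mem_or_mem h1).resolve_right hjP)
    exact hjP (hm (mem_idealOfVars_of_isHomogeneous (hf j) (he j)))
  -- Only the `k - 1 - p < t` forms after `f p` are left to reach `𝔪` from `P`.
  have hle := hd.le_card hJ hP ((Finset.univ.filter (p < ·)).image f) (by
      intro v hv
      obtain ⟨j, -, rfl⟩ := Finset.mem_image.1 (Finset.mem_coe.1 hv)
      exact mem_idealOfVars_of_isHomogeneous (hf j) (he j)) (by
      refine hrad.trans (Ideal.radical_mono (Ideal.span_le.2 ?_))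
      rintro _ ⟨j, rfl⟩
      by_cases hj : j ≤ p
      · exact Ideal.mem_sup_left (hfP j hj)
      · refine Ideal.mem_sup_right (Ideal.subset_span ?_)
        exact Finset.mem_coe.2 (Finset.mem_image_of_mem f (by simpa using hj)))
  have hcard : ((Finset.univ.filter (p < ·)).image f).card ≤ k - 1 - p :=
    Finset.card_image_le.trans (by rw [Finset.filter_lt_eq_Ioi, Fin.card_Ioi])
  have := p.2
  omega

variable [Infinite K]

/-- `J` is generated by a regular sequence built one form at a time, with degrees `e j` for `k - n ≤
j < k - n + i`; the depth kept in the statement makes the next choice possible. -/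
theorem exists_hilbertSeries_eq (hf : ∀ j, (f j).IsHomogeneous (e j)) (he : ∀ j, e j ≠ 0)
    (hmono : Monotone e) (hrad : idealOfVars (Fin n) K ≤ (Ideal.span (Set.range f)).radical)
    (hnk : n ≤ k) {i : ℕ} (hi : i ≤ n) :
    ∃ J : Ideal (MvPolynomial (Fin n) K), IsGradedIdeal J ∧ J ≤ Ideal.span (Set.range f) ∧
      HasDepth (n - i) J ∧ hilbertSeries J = hilbertSeries (⊥ : Ideal (MvPolynomial (Fin n) K)) *
        ∏ j ∈ Finset.univ.filter fun j : Fin k => k ≤ (j : ℕ) + n ∧ (j : ℕ) + n < k + i,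
          (1 - PowerSeries.X ^ e j) := by
  induction i with
  | zero =>
    refine ⟨⊥, isGradedIdeal_bot, bot_le, hasDepth_bot, ?_⟩
    rw [Finset.filter_false_of_mem (fun j _ => by omega), Finset.prod_empty, mul_one]
  | succ i ih =>
    obtain ⟨J, hJ, hJf, hd, hH⟩ := ih (by omega)
    -- Exactly `n - i - 1` forms come after this position, one fewer than the depth of `J`.
    let p : Fin k := ⟨k - n + i, by omega⟩
    obtain ⟨v, hv, hvS⟩ := exists_mem_forall_notMem_ideal
      (idealPart (Ideal.span (Set.range f)) (e p))
      (associatedPrimes.finite (MvPolynomial (Fin n) K) (MvPolynomial (Fin n) K ⧸ J))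
      (fun P hP => hd.exists_notMem hf he hmono hrad hJ hP p (by simp only [p]; omega))
    have hreg := regularMod_of_forall_associatedPrimes hvS
    obtain ⟨hvh, hvf⟩ := mem_idealPart.1 hv
    have hv0 : v ≠ 0 := by
      rintro rfl
      have h1 : (1 : MvPolynomial (Fin n) K) ∈ J := hreg 1 (by rw [zero_mul]; exact J.zero_mem)
      have h2 := mem_idealOfVars_iff.1 (span_range_le_idealOfVars hf he (hJf h1))
      rw [coeff_zero_one] at h2
      exact one_ne_zero h2
    refine ⟨J ⊔ Ideal.span {v}, hJ.sup_span hvh,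
      sup_le hJf ((Ideal.span_singleton_le_iff_mem _).2 hvf), ?_, ?_⟩
    · rw [show n - i = n - (i + 1) + 1 by omega] at hd
      exact hd.sup_span hreg
    · rw [hilbertSeries_sup_span hJ hvh hv0 hreg, hH, mul_assoc]
      congr 1
      have hfil : (Finset.univ.filter fun j : Fin k => k ≤ (j : ℕ) + n ∧ (j : ℕ) + n < k + (i + 1)) =
          insert p (Finset.univ.filter fun j : Fin k => k ≤ (j : ℕ) + n ∧ (j : ℕ) + n < k + i) := by
        ext j
        simp only [Finset.mem_filter, Finset.mem_univ, true_and, Finset.mem_insert, Fin.ext_iff, p]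
        omega
      rw [hfil, Finset.prod_insert (by simp [p]; omega), mul_comm]

/-- If the forms `f`, ordered by degree, generate an ideal with radical `(α₁, …, αₙ)`, there are
at least `n` of them, and the ideal contains all forms of degree greater than the sum of
`e j - 1` over the last `n` of the degrees `e j`. -/
theorem mem_span_of_sum_lt (hf : ∀ j, (f j).IsHomogeneous (e j)) (he : ∀ j, e j ≠ 0)
    (hmono : Monotone e) (hrad : idealOfVars (Fin n) K ≤ (Ideal.span (Set.range f)).radical)
    {D : ℕ} {u : MvPolynomial (Fin n) K} (hu : u.IsHomogeneous D)
    (hD : ∑ j ∈ Finset.univ.filter fun j : Fin k => k ≤ (j : ℕ) + n, (e j - 1) < D) : u ∈ Ideal.span (Set.range f) := by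
  have hnk := le_of_idealOfVars_le_radical hf he hrad
  obtain ⟨J, -, hJf, -, hH⟩ := exists_hilbertSeries_eq hf he hmono hrad hnk le_rfl
  have hfil : (Finset.univ.filter fun j : Fin k => k ≤ (j : ℕ) + n ∧ (j : ℕ) + n < k + n) =
      Finset.univ.filter fun j : Fin k => k ≤ (j : ℕ) + n :=
    Finset.filter_congr fun j _ => by omega
  rw [hfil] at hH
  exact hJf (mem_of_hilbertSeries_eq (card_filter_le_add hnk) hH hD hu)

end Hilbert

/-! ### Degree bounds from generators of an ideal that misses a form. -/

section DegreeBounds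

variable {K : Type*} [Field K] {n : ℕ} {I : Ideal (MvPolynomial (Fin n) K)} {d : ℕ}

theorem IsMinimalGenerator.degree_ne_zero (hI : I ≠ ⊤) {j : ℕ} {Θ : MvPolynomial (Fin n) K}
    (h : IsMinimalGenerator I j Θ) : j ≠ 0 := by
  rintro rfl
  obtain ⟨hΘ, hhom, hmin⟩ := h
  have hC : Θ = C (coeff 0 Θ) := by
    rw [← homogeneousComponent_zero, homogeneousComponent_eq_self hhom]
  have h0 : coeff 0 Θ ≠ 0 := by
    intro h0
    rw [h0, C_0] at hC
    exact hmin (hC ▸ zero_mem _)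
  refine hI (Ideal.eq_top_of_isUnit_mem I hΘ ?_)
  rw [hC]
  exact (isUnit_iff_ne_zero.2 h0).map C

/-- The minimal generators of degree at most `δ` generate the truncated ideal. -/
theorem truncatedIdeal_le_span {s : ℕ} {Θ : Fin s → MvPolynomial (Fin n) K} {deg : Fin s → ℕ}
    (h : IsMinimalGeneratingSystem I Θ deg) {δ : ℕ} {κ : Fin s}
    (hκ : ∀ j : Fin s, κ < j → δ < deg j) :
    truncatedIdeal I δ ≤ Ideal.span (Set.range fun j : Fin (κ + 1) => Θ (j.castLE κ.2)) := by
  rw [truncatedIdeal, Ideal.span_le]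
  rintro p ⟨hpI, j, hj, hp⟩
  rw [← h.span_eq] at hpI
  obtain ⟨c, rfl⟩ := Ideal.mem_span_range_iff_exists_fun.1 hpI
  rw [SetLike.mem_coe, ← homogeneousComponent_eq_self hp, map_sum]
  refine Ideal.sum_mem _ fun i _ => ?_
  rw [mul_comm, homogeneousComponent_mul_of_isHomogeneous (h.isMinimalGenerator i).2.1]
  split_ifs with hij
  · have hi : i ≤ κ := not_lt.1 fun hlt => absurd (hκ i hlt) (by omega)
    exact Ideal.mul_mem_right _ _ (Ideal.subset_span
      ⟨⟨i, Nat.lt_succ_of_le hi⟩, rfl⟩)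
  · exact zero_mem _

/-- A graded ideal is generated in degrees at most `δ` if its minimal generators are. -/
theorem mem_truncatedIdeal_of_isHomogeneous (hI : IsGradedIdeal I) {δ : ℕ}
    (hδ : ∀ j Θ, IsMinimalGenerator I j Θ → j ≤ δ) (j : ℕ) :
    ∀ Θ ∈ I, Θ.IsHomogeneous j → Θ ∈ truncatedIdeal I δ := by
  induction j using Nat.strong_induction_on with
  | _ j ih =>
    intro Θ hΘ hhom
    rcases le_or_gt j δ with hj | hj
    · exact Ideal.subset_span ⟨hΘ, j, hj, hhom⟩
    have hmem : Θ ∈ idealOfVars (Fin n) K * I := by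
      by_contra hn
      exact absurd (hδ j Θ ⟨hΘ, hhom, hn⟩) (by omega)
    -- In degree `j`, a product of `X i` and an element of `I` is `X i` times a degree `j - 1`
    -- component, which the induction covers.
    have key : ∀ p ∈ idealOfVars (Fin n) K * I,
        homogeneousComponent j p ∈ truncatedIdeal I δ := by
      intro p hp
      refine Submodule.mul_induction_on hp (fun a ha b hb => ?_) (fun p q hp hq => ?_)
      · obtain ⟨c, rfl⟩ := Ideal.mem_span_range_iff_exists_fun.1 ha
        rw [Finset.sum_mul, map_sum]
        refine Ideal.sum_mem _ fun i _ => ?_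
        rw [mul_comm (c i), mul_assoc,
          homogeneousComponent_mul_of_isHomogeneous (isHomogeneous_X K i)]
        split_ifs with h1
        · exact Ideal.mul_mem_left _ _ (ih (j - 1) (by omega) _
            (hI _ (I.mul_mem_left _ hb) _) (homogeneousComponent_isHomogeneous _ _))
        · exact zero_mem _
      · rw [map_add]
        exact add_mem hp hq
    rw [← homogeneousComponent_eq_self hhom]
    exact key Θ hmem

variable [Infinite K]

theorem le_and_le_sum_of_notMem_span {k : ℕ} {f : Fin k → MvPolynomial (Fin n) K} {e : Fin k → ℕ}
    (hf : ∀ j, (f j).IsHomogeneous (e j)) (he : ∀ j, e j ≠ 0) (hmono : Monotone e)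
    (hrad : idealOfVars (Fin n) K ≤ (Ideal.span (Set.range f)).radical) {d : ℕ}
    {u : MvPolynomial (Fin n) K} (hu : u.IsHomogeneous d) (huf : u ∉ Ideal.span (Set.range f)) :
    n ≤ k ∧ (d : ℤ) ≤
      (∑ j ∈ Finset.univ.filter fun j : Fin k => k ≤ (j : ℕ) + n, (e j : ℤ)) - n := by
  have hnk := le_of_idealOfVars_le_radical hf he hrad
  refine ⟨hnk, ?_⟩
  have h1 : d ≤ ∑ j ∈ Finset.univ.filter fun j : Fin k => k ≤ (j : ℕ) + n, (e j - 1) := by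
    by_contra! hlt
    exact huf (mem_span_of_sum_lt hf he hmono hrad hu hlt)
  have h2 : ((∑ j ∈ Finset.univ.filter fun j : Fin k => k ≤ (j : ℕ) + n, (e j - 1) : ℕ) : ℤ) =
      (∑ j ∈ Finset.univ.filter fun j : Fin k => k ≤ (j : ℕ) + n, (e j : ℤ)) - n := by
    have h3 : ∀ j, ((e j - 1 : ℕ) : ℤ) = (e j : ℤ) - 1 := fun j => by
      have := he j
      omega
    rw [Nat.cast_sum]
    simp only [h3]
    rw [Finset.sum_sub_distrib, Finset.sum_const, card_filter_le_add hnk]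
    simp
  rw [← h2]
  exact_mod_cast h1

theorem le_sum_degrees_of_isMinimalGeneratingSystem {u : MvPolynomial (Fin n) K}
    (hu : u.IsHomogeneous d) (huI : u ∉ I)
    {s : ℕ} {Θ : Fin s → MvPolynomial (Fin n) K} {deg : Fin s → ℕ}
    (h : IsMinimalGeneratingSystem I Θ deg) (hmono : Monotone deg) {δ : ℕ}
    (hδ : IsIrrelevantPrimary (truncatedIdeal I δ)) {κ : Fin s}
    (hκ : ∀ j : Fin s, κ < j → δ < deg j) :
    n ≤ (κ : ℕ) + 1 ∧
      (d : ℤ) ≤ (∑ i : Fin s with i ≤ κ ∧ (κ : ℕ) < (i : ℕ) + n, (deg i : ℤ)) - n := by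
  have hI : I ≠ ⊤ := fun hI => huI (hI ▸ Submodule.mem_top)
  have hle : Ideal.span (Set.range fun j : Fin (κ + 1) => Θ (j.castLE κ.2)) ≤ I := by
    rw [Ideal.span_le]
    rintro _ ⟨j, rfl⟩
    exact (h.isMinimalGenerator _).1
  obtain ⟨h1, h2⟩ := le_and_le_sum_of_notMem_span (e := fun j : Fin (κ + 1) => deg (j.castLE κ.2))
    (fun j => (h.isMinimalGenerator _).2.1)
    (fun j => (h.isMinimalGenerator _).degree_ne_zero hI)
    -- The first `κ + 1` generators include all those of degree at most `δ`.
    (fun i j hij => hmono hij) (by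
      rw [← hδ.2]
      exact Ideal.radical_mono (truncatedIdeal_le_span h hκ)) hu (fun hmem => huI (hle hmem))
  refine ⟨h1, h2.trans (le_of_eq ?_)⟩
  congr 1
  refine Finset.sum_bij (fun j _ => j.castLE κ.2) ?_ ?_ ?_ ?_
  · intro j hj
    have hj' := (Finset.mem_filter.1 hj).2
    refine Finset.mem_filter.2 ⟨Finset.mem_univ _, Nat.le_of_lt_succ j.2, ?_⟩
    rw [Fin.val_castLE]
    omega
  · intro i _ j _ hij
    exact Fin.castLE_injective _ hij
  · intro i hi
    obtain ⟨-, hi1, hi2⟩ := Finset.mem_filter.1 hi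
    exact ⟨⟨i, Nat.lt_succ_of_le hi1⟩, Finset.mem_filter.2 ⟨Finset.mem_univ _, hi2⟩, rfl⟩
  · intro j _
    rfl

theorem le_of_isGreatest_degree_isMinimalGenerator (hI : IsGradedIdeal I)
    (hvan : ∀ D, d < D → ∀ Θ : MvPolynomial (Fin n) K, Θ.IsHomogeneous D → Θ ∈ I)
    {u : MvPolynomial (Fin n) K} (hu : u.IsHomogeneous d) (huI : u ∉ I) {δ : ℕ}
    (hδ : IsGreatest {j : ℕ | ∃ Θ, IsMinimalGenerator I j Θ} δ) :
    (d : ℤ) ≤ ((δ : ℤ) - 1) * n := by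
  have hItop : I ≠ ⊤ := fun hI => huI (hI ▸ Submodule.mem_top)
  obtain ⟨⟨Θ, hΘ⟩, hub⟩ := hδ
  have hδ0 := hΘ.degree_ne_zero hItop
  have htr := mem_truncatedIdeal_of_isHomogeneous hI fun j Θ h => hub ⟨Θ, h⟩
  -- Finitely many forms, all of degree exactly `δ`, so that the sum in the bound becomes `n * (δ -
  -- 1)`.
  obtain ⟨G, hG, hspan⟩ := (Submodule.fg_span_iff_fg_span_finset_subset
    (idealPart I δ : Set (MvPolynomial (Fin n) K))).1
    (IsNoetherian.noetherian (Ideal.span (idealPart I δ : Set (MvPolynomial (Fin n) K))))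
  let f : Fin G.card → MvPolynomial (Fin n) K := fun j => G.equivFin.symm j
  have hfG : ∀ j, f j ∈ idealPart I δ := fun j => hG (G.equivFin.symm j).2
  have hrange : Set.range f = G := by
    ext p
    refine ⟨?_, fun hp => ⟨G.equivFin ⟨p, hp⟩, by simp [f]⟩⟩
    rintro ⟨j, rfl⟩
    exact (G.equivFin.symm j).2
  have hf : Ideal.span (Set.range f) = Ideal.span (idealPart I δ) := by
    rw [hrange]
    exact hspan.symm
  have hpow : ∀ (i : Fin n) (p : MvPolynomial (Fin n) K), p ∈ truncatedIdeal I δ →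
      X i ^ δ * p ∈ Ideal.span (idealPart I δ : Set (MvPolynomial (Fin n) K)) := by
    intro i p hp
    refine Submodule.span_induction ?_ ?_ ?_ ?_ hp
    · rintro q ⟨hq, j, hj, hhom⟩
      have h1 : X i ^ (δ - j) * q ∈ idealPart I δ := by
        refine mem_idealPart.2 ⟨?_, I.mul_mem_left _ hq⟩
        have h2 := (isHomogeneous_X_pow (R := K) i (δ - j)).mul hhom
        rwa [Nat.sub_add_cancel hj] at h2
      have h3 : (X i : MvPolynomial (Fin n) K) ^ δ = X i ^ j * X i ^ (δ - j) := by
        rw [← pow_add, Nat.add_sub_cancel' hj]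
      rw [h3, mul_assoc]
      exact Ideal.mul_mem_left _ _ (Ideal.subset_span h1)
    · rw [mul_zero]
      exact zero_mem _
    · intro p q _ _ hp hq
      rw [mul_add]
      exact add_mem hp hq
    · intro a p _ hp
      rw [smul_eq_mul, mul_left_comm]
      exact Ideal.mul_mem_left _ _ hp
  have hrad : idealOfVars (Fin n) K ≤ (Ideal.span (Set.range f)).radical := by
    rw [hf, Ideal.span_le]
    rintro _ ⟨i, rfl⟩
    -- `X i ^ (d + 1)` lies in `I` for degree reasons, hence in the truncated ideal; the factor `X i
    -- ^ δ` moves it into the ideal of the degree `δ` piece.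
    refine ⟨δ + (d + 1), ?_⟩
    rw [pow_add]
    have h1 := isHomogeneous_X_pow (R := K) i (d + 1)
    exact hpow i _ (htr _ _ (hvan _ (Nat.lt_succ_self d) _ h1) h1)
  have hle : Ideal.span (Set.range f) ≤ I := by
    rw [hf, Ideal.span_le]
    exact fun p hp => (mem_idealPart.1 hp).2
  obtain ⟨h1, h2⟩ := le_and_le_sum_of_notMem_span (e := fun _ => δ)
    (fun j => (mem_idealPart.1 (hfG j)).1) (fun _ => hδ0) monotone_const hrad hu
    (fun hmem => huI (hle hmem))
  rw [Finset.sum_const, card_filter_le_add h1, nsmul_eq_mul] at h2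
  linarith

end DegreeBounds

/-! ### Apolar ideals, and the passage from differentiation to contraction. -/

section Apolarity

variable {K : Type*} [Field K] {n : ℕ}

theorem mem_dpApolarIdeal {F : DividedPowerPoly K n} {Θ : MvPolynomial (Fin n) K} :
    Θ ∈ dpApolarIdeal F ↔ operatorAction contraction contraction_commute Θ F = 0 := Iff.rfl

theorem contraction_pow_apply (i : Fin n) (m : ℕ) (F : DividedPowerPoly K n) (b : Fin n →₀ ℕ) :
    ((contraction i ^ m : Module.End K (DividedPowerPoly K n)) F) b =
      F (b + Finsupp.single i m) := by
  induction m generalizing b with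
  | zero => simp
  | succ m ih =>
    rw [pow_succ', Module.End.mul_apply, contraction_apply, ih, add_assoc,
      ← Finsupp.single_add, add_comm 1 m]

theorem operatorAction_contraction_monomial_one (a : Fin n →₀ ℕ) :
    ∀ (F : DividedPowerPoly K n) (b : Fin n →₀ ℕ),
      operatorAction contraction contraction_commute (monomial a 1) F b = F (b + a) := by
  induction a using Finsupp.induction_linear with
  | zero =>
    intro F b
    rw [monomial_zero', C_1, map_one, Module.End.one_apply, add_zero]
  | add a a' ih ih' =>
    intro F b
    have h : (monomial (a + a') 1 : MvPolynomial (Fin n) K) = monomial a 1 * monomial a' 1 := by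
      rw [monomial_mul, one_mul]
    rw [h, map_mul, Module.End.mul_apply, ih, ih', add_assoc]
  | single i m =>
    intro F b
    rw [← X_pow_eq_monomial, map_pow, operatorAction_X, contraction_pow_apply]

theorem operatorAction_contraction_monomial (a : Fin n →₀ ℕ) (c : K)
    (F : DividedPowerPoly K n) (b : Fin n →₀ ℕ) :
    operatorAction contraction contraction_commute (monomial a c) F b = c * F (b + a) := by
  have h : (monomial a c : MvPolynomial (Fin n) K) = c • monomial a 1 := by
    rw [smul_monomial, smul_eq_mul, mul_one]
  rw [h, map_smul, LinearMap.smul_apply, Finsupp.smul_apply, smul_eq_mul,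
    operatorAction_contraction_monomial_one]

/-- As `F` lives in degree `d`, its coefficient reached at `b` comes only from monomials of `Θ` of
degree `d - |b|`. This gives both the grading of `F^⊥` and the vanishing above `d`. -/
theorem operatorAction_contraction_homogeneousComponent {F : DividedPowerPoly K n} {d : ℕ}
    (hF : F.IsForm d) (Θ : MvPolynomial (Fin n) K) (j : ℕ) (b : Fin n →₀ ℕ) :
    operatorAction contraction contraction_commute (homogeneousComponent j Θ) F b =
      if j + b.degree = d then operatorAction contraction contraction_commute Θ F b else 0 := by
  induction Θ using MvPolynomial.induction_on' with
  | monomial a c =>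
    have hvan : ∀ m, b.degree + a.degree ≠ m → m = d → F (b + a) = 0 := by
      rintro m hm rfl
      by_contra hne
      exact hm (by rw [← hF _ hne, map_add])
    rw [homogeneousComponent_of_mem
      ((mem_homogeneousSubmodule _ _).2 (isHomogeneous_monomial c rfl))]
    by_cases hja : j = a.degree
    · rw [if_pos hja, operatorAction_contraction_monomial]
      split_ifs with hd
      · rfl
      · rw [hvan d (by omega) rfl, mul_zero]
    · rw [if_neg hja, map_zero, LinearMap.zero_apply, Finsupp.zero_apply,
        operatorAction_contraction_monomial]
      split_ifs with hd
      · rw [hvan d (by omega) rfl, mul_zero]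
      · rfl
  | add p q hp hq =>
    rw [map_add, map_add, map_add, LinearMap.add_apply, LinearMap.add_apply, Finsupp.add_apply,
      Finsupp.add_apply, hp, hq]
    split_ifs
    · rfl
    · rw [add_zero]

theorem isGradedIdeal_dpApolarIdeal {F : DividedPowerPoly K n} {d : ℕ} (hF : F.IsForm d) :
    IsGradedIdeal (dpApolarIdeal F) := by
  intro Θ hΘ j
  rw [mem_dpApolarIdeal] at hΘ ⊢
  ext b
  rw [operatorAction_contraction_homogeneousComponent hF, hΘ, Finsupp.zero_apply, ite_self]

theorem mem_dpApolarIdeal_of_lt {F : DividedPowerPoly K n} {d D : ℕ} (hF : F.IsForm d)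
    (hD : d < D) {Θ : MvPolynomial (Fin n) K} (hΘ : Θ.IsHomogeneous D) :
    Θ ∈ dpApolarIdeal F := by
  rw [mem_dpApolarIdeal]
  ext b
  rw [← homogeneousComponent_eq_self hΘ, operatorAction_contraction_homogeneousComponent hF,
    if_neg (by omega), Finsupp.zero_apply]

theorem exists_isHomogeneous_notMem_dpApolarIdeal {F : DividedPowerPoly K n} {d : ℕ}
    (hF0 : F ≠ 0) (hF : F.IsForm d) :
    ∃ u : MvPolynomial (Fin n) K, u.IsHomogeneous d ∧ u ∉ dpApolarIdeal F := by
  obtain ⟨b, hb⟩ := Finsupp.ne_iff.1 hF0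
  -- Contraction by this monomial has constant coefficient `F b`.
  refine ⟨monomial b 1, isHomogeneous_monomial 1 (hF b hb), fun h => hb ?_⟩
  rw [mem_dpApolarIdeal] at h
  rw [Finsupp.zero_apply, ← zero_add b, ← operatorAction_contraction_monomial_one, h,
    Finsupp.zero_apply]

/-- The map `x^b ↦ b! x^(b)` from polynomials to divided power polynomials. -/
noncomputable def toDividedPower : MvPolynomial (Fin n) K →ₗ[K] DividedPowerPoly K n where
  toFun p := Finsupp.onFinset p.support (fun b => (∏ i, ((b i).factorial : K)) * coeff b p)
    fun b hb => mem_support_iff.2 (right_ne_zero_of_mul hb)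
  map_add' p q := by
    ext b
    simp only [Finsupp.onFinset_apply, Finsupp.add_apply, coeff_add, mul_add]
  map_smul' c p := by
    ext b
    simp only [Finsupp.onFinset_apply, Finsupp.smul_apply, coeff_smul, smul_eq_mul,
      RingHom.id_apply, mul_left_comm]

theorem toDividedPower_apply (p : MvPolynomial (Fin n) K) (b : Fin n →₀ ℕ) :
    toDividedPower p b = (∏ i, ((b i).factorial : K)) * coeff b p := rfl

theorem toDividedPower_eq_zero_iff [CharZero K] {p : MvPolynomial (Fin n) K} :
    toDividedPower p = 0 ↔ p = 0 := by
  refine ⟨fun h => ?_, fun h => by rw [h, map_zero]⟩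
  ext b
  have hb := DFunLike.congr_fun h b
  rw [toDividedPower_apply, Finsupp.zero_apply] at hb
  rw [coeff_zero]
  exact (mul_eq_zero.1 hb).resolve_left
    (Finset.prod_ne_zero_iff.2 fun i _ => Nat.cast_ne_zero.2 (Nat.factorial_ne_zero _))

theorem isForm_toDividedPower {p : MvPolynomial (Fin n) K} {d : ℕ} (hp : p.IsHomogeneous d) :
    (toDividedPower p).IsForm d := by
  intro b hb
  by_contra hd
  exact hb (by rw [toDividedPower_apply, hp.coeff_eq_zero hd, mul_zero])

/-- The factor `b i + 1` produced by differentiation turns `b!` into `(b + eᵢ)!`. -/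
theorem toDividedPower_partialDerivative (i : Fin n) (p : MvPolynomial (Fin n) K) :
    toDividedPower (partialDerivative i p) = contraction i (toDividedPower p) := by
  classical
  ext b
  rw [contraction_apply, toDividedPower_apply, toDividedPower_apply,
    show partialDerivative i p = pderiv i p from rfl, coeff_pderiv, mul_comm (coeff _ _), ← mul_assoc]
  congr 1
  obtain ⟨b', hb'⟩ : ∃ b' : Fin n →₀ ℕ, b' = b + Finsupp.single i 1 := ⟨_, rfl⟩
  rw [← hb', ← Finset.mul_prod_erase _ _ (Finset.mem_univ i),
    ← Finset.mul_prod_erase _ (fun j => ((b' j).factorial : K)) (Finset.mem_univ i)]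
  have h1 : ∏ j ∈ Finset.univ.erase i, ((b' j).factorial : K) =
      ∏ j ∈ Finset.univ.erase i, ((b j).factorial : K) :=
    Finset.prod_congr rfl fun j hj => by
      rw [hb', Finsupp.add_apply, Finsupp.single_eq_of_ne (Finset.ne_of_mem_erase hj), add_zero]
  rw [h1, hb', Finsupp.add_apply, Finsupp.single_eq_same, Nat.factorial_succ]
  push_cast
  ring

theorem toDividedPower_operatorAction (Θ : MvPolynomial (Fin n) K) :
    ∀ p : MvPolynomial (Fin n) K,
      toDividedPower (operatorAction partialDerivative partialDerivative_commute Θ p) =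
        operatorAction contraction contraction_commute Θ (toDividedPower p) := by
  induction Θ using MvPolynomial.induction_on with
  | C c =>
    intro p
    rw [← algebraMap_eq, AlgHom.commutes, AlgHom.commutes, Module.algebraMap_end_apply,
      Module.algebraMap_end_apply, map_smul]
  | add Θ Ψ hΘ hΨ =>
    intro p
    rw [map_add, map_add, LinearMap.add_apply, LinearMap.add_apply, map_add, hΘ, hΨ]
  | mul_X Θ i hΘ =>
    intro p
    rw [map_mul, map_mul, Module.End.mul_apply, Module.End.mul_apply, hΘ, operatorAction_X,
      operatorAction_X, toDividedPower_partialDerivative]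

/-- In characteristic zero, apolarity by differentiation is apolarity by contraction. -/
theorem apolarIdeal_eq_dpApolarIdeal [CharZero K] (F : MvPolynomial (Fin n) K) :
    apolarIdeal F = dpApolarIdeal (toDividedPower F) := by
  ext Θ
  rw [mem_dpApolarIdeal, ← toDividedPower_operatorAction, toDividedPower_eq_zero_iff]
  exact Iff.rfl

end Apolarity

end

theorem mainTheorem4 {K : Type*} [Field K] [IsAlgClosed K] (n d : ℕ) :
    -- ordinary forms in characteristic zero, with the action by differentiation
    ([CharZero K] → ∀ F : MvPolynomial (Fin n) K, F ≠ 0 → F.IsHomogeneous d →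
      (∀ δ : ℕ, IsGreatest {j : ℕ | ∃ Θ, IsMinimalGenerator (apolarIdeal F) j Θ} δ →
        (d : ℤ) ≤ ((δ : ℤ) - 1) * n) ∧
      (∀ (s : ℕ) (Θ : Fin s → MvPolynomial (Fin n) K) (deg : Fin s → ℕ),
        IsMinimalGeneratingSystem (apolarIdeal F) Θ deg → Monotone deg →
        ∀ δ : ℕ, IsIrrelevantPrimary (truncatedIdeal (apolarIdeal F) δ) →
        -- `k = κ + 1` is the index (counted from one) with `d_k = δ < d_{k+1}`, or `k = s`
        ∀ κ : Fin s, deg κ = δ → (∀ j : Fin s, κ < j → δ < deg j) →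
          n ≤ (κ : ℕ) + 1 ∧
          (d : ℤ) ≤ (∑ i : Fin s with i ≤ κ ∧ (κ : ℕ) < (i : ℕ) + n, (deg i : ℤ)) - n)) ∧
    -- divided power forms in any characteristic, with the action by contraction
    (∀ F : DividedPowerPoly K n, F ≠ 0 → F.IsForm d →
      (∀ δ : ℕ, IsGreatest {j : ℕ | ∃ Θ, IsMinimalGenerator (dpApolarIdeal F) j Θ} δ →
        (d : ℤ) ≤ ((δ : ℤ) - 1) * n) ∧
      (∀ (s : ℕ) (Θ : Fin s → MvPolynomial (Fin n) K) (deg : Fin s → ℕ),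
        IsMinimalGeneratingSystem (dpApolarIdeal F) Θ deg → Monotone deg →
        ∀ δ : ℕ, IsIrrelevantPrimary (truncatedIdeal (dpApolarIdeal F) δ) →
        ∀ κ : Fin s, deg κ = δ → (∀ j : Fin s, κ < j → δ < deg j) →
          n ≤ (κ : ℕ) + 1 ∧
          (d : ℤ) ≤ (∑ i : Fin s with i ≤ κ ∧ (κ : ℕ) < (i : ℕ) + n, (deg i : ℤ)) - n)) := by
  have key : ∀ F : DividedPowerPoly K n, F ≠ 0 → F.IsForm d →
      (∀ δ : ℕ, IsGreatest {j : ℕ | ∃ Θ, IsMinimalGenerator (dpApolarIdeal F) j Θ} δ →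
        (d : ℤ) ≤ ((δ : ℤ) - 1) * n) ∧
      (∀ (s : ℕ) (Θ : Fin s → MvPolynomial (Fin n) K) (deg : Fin s → ℕ),
        IsMinimalGeneratingSystem (dpApolarIdeal F) Θ deg → Monotone deg →
        ∀ δ : ℕ, IsIrrelevantPrimary (truncatedIdeal (dpApolarIdeal F) δ) →
        ∀ κ : Fin s, deg κ = δ → (∀ j : Fin s, κ < j → δ < deg j) →
          n ≤ (κ : ℕ) + 1 ∧
          (d : ℤ) ≤ (∑ i : Fin s with i ≤ κ ∧ (κ : ℕ) < (i : ℕ) + n, (deg i : ℤ)) - n) := by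
    intro F hF0 hF
    obtain ⟨u, hu, huI⟩ := exists_isHomogeneous_notMem_dpApolarIdeal hF0 hF
    exact ⟨fun δ hδ => le_of_isGreatest_degree_isMinimalGenerator (isGradedIdeal_dpApolarIdeal hF)
        (fun D hD Θ hΘ => mem_dpApolarIdeal_of_lt hF hD hΘ) hu huI hδ,
      fun s Θ deg h hmono δ hδ κ _ hκ =>
        le_sum_degrees_of_isMinimalGeneratingSystem hu huI h hmono hδ hκ⟩
  refine ⟨fun F hF0 hF => ?_, key⟩
  -- Characteristic zero makes the factorials invertible, so this case reduces to divided powers.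
  rw [apolarIdeal_eq_dpApolarIdeal]
  exact key _ (mt toDividedPower_eq_zero_iff.1 hF0) (isForm_toDividedPower hF)
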